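/- A weighted digraph $G=(V,E,w)$ consists of a finite set $V$, a set $E\subseteq V\times V$ containing no pair $(i,i)$, and a function $w:E\to(0,\infty)$. Let $d(i,j)\in[0,\infty]$ be the minimal total weight of a directed path from $i$ to $j$ in $G$ ($\infty$ if there is none), and let $G^t$ be the digraph on $V$ with edges $\{(i,j): i\neq j,\ d(i,j)\le t\}$. For a digraph $H$, let $\Omega_\bullet(H)$ be its regular path complex over $\mathbb R$. The grounded persistent path homology $\mathcal H_1(G)$ is the persistent real vector space that is zero for $t<0$ and, for $t\ge 0$, is $$\mathcal H_1(G)(t)=\frac{\ker\big(\partial_1:\Omega_1(G\cup G^t)\to\Omega_0(G\cup G^t)\big)}{\partial_2\big(\Omega_2(G^t)\big)},$$ with the maps induced by inclusions. Its barcode $\mathrm{Bar}(G)$ is the multiset of non-empty real intervals $I$ (unique) such that $\mathcal H_1(G)$ is isomorphic to the direct sum of the corresponding interval modules, and $d_B\in[0,\infty]$ is the bottleneck distance ($\ell^\infty$ matching of interval end points, points of the diagonal being added to both diagrams). For $e\in E$, let $G\setminus e$ be $G$ with the edge $e$ deleted, and let the neighbourhood graph $N(e;G)$ be the weighted subgraph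 of $G$ whose edges are all edges of $G$ sharing a vertex with $e$ (including $e$) and whose vertices are the vertices incident to these edges. **Theorem.** There is no function $f$ from weighted digraphs to $\mathbb R$ such that for every weighted digraph $G=(V,E,w)$ and every edge $e\in E$ $$d_B\big(\mathrm{Bar}(G),\mathrm{Bar}(G\setminus e)\big)\le f\big(N(e;G)\big).$$ Moreover, for $W\ge 1$ let $G_W$ be the weighted digraph on $\{v_0,v_1,v_2,v_3\}$ with edges $(v_0,v_1)$, $(v_1,v_3)$, $(v_2,v_3)$ of weight $1$ and an edge $(v_0,v_2)$ of weight $W$, and let $e=(v_1,v_3)$. Then $N(e;G_W)$ does not depend on $W$, the unique barcode of $\mathcal H_1(G_W)$ is $\{[0,W)\}$, the unique barcode of $\mathcal H_1(G_W\setminus e)$ is empty, and $d_B(\mathrm{Bar}(G_W),\mathrm{Bar}(G_W\setminus e))=W/2$. -/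

import Mathlib

noncomputable section

namespace GrPPH

/-! ### Weighted digraphs -/

/-- A finite simple weighted digraph: no self-loops, and a positive weight on every edge. The weight
function is defined on the edges only. -/
structure WDgr where
  V : Type
  [finite : Finite V]
  E : Set (V × V)
  loopless : ∀ i, (i, i) ∉ E
  w : E → ℝ
  w_pos : ∀ e, 0 < w e

/-- Directed walks (alternating sequences of vertices and forward edges). -/
inductive WDgr.Walk (G : WDgr) : G.V → G.V → Type
  | nil (i : G.V) : WDgr.Walk G i i
  | cons {i j k : G.V} (e : (i, j) ∈ G.E) (p : WDgr.Walk G j k) : WDgr.Walk G i k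

/-- The total weight of the edges of a walk. -/
def WDgr.Walk.length {G : WDgr} : {i j : G.V} → G.Walk i j → ℝ
  | _, _, .nil _ => 0
  | _, _, .cons e p => G.w ⟨_, e⟩ + p.length

/-- The vertices of a walk, in order. -/
def WDgr.Walk.support {G : WDgr} : {i j : G.V} → G.Walk i j → List G.V
  | _, _, .nil i => [i]
  | i, _, .cons _ p => i :: p.support

/-- A path is a walk that repeats no vertex. -/
def WDgr.Walk.IsPath {G : WDgr} {i j : G.V} (p : G.Walk i j) : Prop := p.support.Nodup

/-- The shortest-path quasimetric, with value `⊤` when there is no path. -/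
def WDgr.dist (G : WDgr) (i j : G.V) : EReal :=
  ⨅ (p : G.Walk i j) (_ : p.IsPath), ((p.length : ℝ) : EReal)

/-- The edges `E^t` of the digraph `G^t` of the shortest-path filtration. -/
def WDgr.filtEdges (G : WDgr) (t : ℝ) : Set (G.V × G.V) :=
  {τ | τ.1 ≠ τ.2 ∧ G.dist τ.1 τ.2 ≤ (t : EReal)}

/-- The edges of `G ∪ G^t`. The filtration starts at time `0`: nothing is present before. -/
def WDgr.groundedEdges (G : WDgr) (t : ℝ) : Set (G.V × G.V) :=
  {τ | 0 ≤ t ∧ (τ ∈ G.E ∨ τ ∈ G.filtEdges t)}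

/-- Deletion of the edge `e`. -/
def WDgr.deleteEdge (G : WDgr) (e : G.V × G.V) : WDgr where
  V := G.V
  finite := G.finite
  E := G.E \ {e}
  loopless i h := G.loopless i h.1
  w τ := G.w ⟨τ.1, τ.2.1⟩
  w_pos _ := G.w_pos _

/-- The subgraph induced on a set `E'` of edges: its vertices are those incident to an edge of `E'`,
its edges are exactly the elements of `E'`. -/
def WDgr.inducedOnEdges (G : WDgr) (E' : Set (G.V × G.V)) (h : E' ⊆ G.E) : WDgr where
  V := {v : G.V // ∃ τ ∈ E', v = τ.1 ∨ v = τ.2}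
  finite := by
    have := G.finite
    infer_instance
  E := {τ | (τ.1.1, τ.2.1) ∈ E'}
  loopless i hi := G.loopless i.1 (h hi)
  w τ := G.w ⟨(τ.1.1.1, τ.1.2.1), h τ.2⟩
  w_pos _ := G.w_pos _

/-- The edges having a vertex in common with some edge in `F`. -/
def WDgr.nbhd (G : WDgr) (F : Set (G.V × G.V)) : Set (G.V × G.V) :=
  {τ | τ ∈ G.E ∧ ∃ e ∈ F, ∃ v : G.V, (v = τ.1 ∨ v = τ.2) ∧ (v = e.1 ∨ v = e.2)}

/-- The neighbourhood graph of a set of edges. -/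
def WDgr.nbhdGraph (G : WDgr) (F : Set (G.V × G.V)) : WDgr :=
  G.inducedOnEdges (G.nbhd F) fun _ h => h.1

/-! ### Regular path chains -/

section Chains

variable {V : Type}

/-- A vertex sequence is regular if consecutive vertices differ. -/
def IsRegular {p : ℕ} (x : Fin (p + 1) → V) : Prop := ∀ i : Fin p, x i.castSucc ≠ x i.succ

/-- A vertex sequence is allowed in the digraph with edge set `E` if all its steps are edges. -/
def IsAllowed (E : Set (V × V)) {p : ℕ} (x : Fin (p + 1) → V) : Prop :=
  ∀ i : Fin p, (x i.castSucc, x i.succ) ∈ E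

/-- The real vector space freely generated by all elementary `p`-paths. -/
abbrev Chains (V : Type) (p : ℕ) : Type := (Fin (p + 1) → V) →₀ ℝ

/-- The span of the allowed `p`-paths. -/
def allowedChains (E : Set (V × V)) (p : ℕ) : Submodule ℝ (Chains V p) :=
  Finsupp.supported ℝ ℝ {x | IsAllowed E x}

/-- The non-regular boundary: the alternating sum of the faces. -/
def nregBoundary (V : Type) (p : ℕ) : Chains V (p + 1) →ₗ[ℝ] Chains V p :=
  Finsupp.linearCombination ℝ fun x =>
    ∑ i : Fin (p + 2), Finsupp.single (fun j => x (i.succAbove j)) ((-1 : ℝ) ^ (i : ℕ))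

open Classical in
/-- The projection onto the span of the regular paths. -/
def regProj (V : Type) (p : ℕ) : Chains V p →ₗ[ℝ] Chains V p :=
  Finsupp.linearCombination ℝ fun x => if IsRegular x then Finsupp.single x 1 else 0

/-- The regular boundary. -/
def boundary (V : Type) (p : ℕ) : Chains V (p + 1) →ₗ[ℝ] Chains V p :=
  regProj V p ∘ₗ nregBoundary V p

/-- The `∂`-invariant `(p + 1)`-paths `Ω_{p+1}` of the digraph with edge set `E`. -/
def omegaSucc (E : Set (V × V)) (p : ℕ) : Submodule ℝ (Chains V (p + 1)) :=
  allowedChains E (p + 1) ⊓ (allowedChains E p).comap (boundary V p)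

lemma allowedChains_mono {E E' : Set (V × V)} (h : E ⊆ E') (p : ℕ) :
    allowedChains E p ≤ allowedChains E' p :=
  Finsupp.supported_mono fun _ hx i => h (hx i)

lemma omegaSucc_mono {E E' : Set (V × V)} (h : E ⊆ E') (p : ℕ) :
    omegaSucc E p ≤ omegaSucc E' p :=
  inf_le_inf (allowedChains_mono h _) (Submodule.comap_mono (allowedChains_mono h _))

end Chains

/-! ### Grounded persistent path homology in degree one -/

/-- A persistent vector space: a functor from the poset of real numbers to real vector spaces. -/
abbrev PersVec : Type 1 := CategoryTheory.Functor ℝ (ModuleCat.{0} ℝ)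

lemma WDgr.filtEdges_mono (G : WDgr) {s t : ℝ} (h : s ≤ t) : G.filtEdges s ⊆ G.filtEdges t :=
  fun _ hτ => ⟨hτ.1, hτ.2.trans (EReal.coe_le_coe_iff.2 h)⟩

lemma WDgr.groundedEdges_mono (G : WDgr) {s t : ℝ} (h : s ≤ t) :
    G.groundedEdges s ⊆ G.groundedEdges t :=
  fun _ hτ => ⟨hτ.1.trans h, hτ.2.imp id fun h' => G.filtEdges_mono h h'⟩

/-- Grounded `1`-cycles: the kernel of `∂₁` on `Ω₁(G ∪ G^t)`. -/
def WDgr.cycles (G : WDgr) (t : ℝ) : Submodule ℝ (Chains G.V 1) :=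
  omegaSucc (G.groundedEdges t) 0 ⊓ LinearMap.ker (boundary G.V 0)

/-- Grounded `1`-boundaries: the image of `Ω₂(G^t)` under `∂₂`. -/
def WDgr.boundaries (G : WDgr) (t : ℝ) : Submodule ℝ (Chains G.V 1) :=
  (omegaSucc (G.filtEdges t) 1).map (boundary G.V 1)

lemma WDgr.cycles_mono (G : WDgr) {s t : ℝ} (h : s ≤ t) : G.cycles s ≤ G.cycles t :=
  inf_le_inf_right _ (omegaSucc_mono (G.groundedEdges_mono h) 0)

lemma WDgr.boundaries_mono (G : WDgr) {s t : ℝ} (h : s ≤ t) : G.boundaries s ≤ G.boundaries t :=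
  Submodule.map_mono (omegaSucc_mono (G.filtEdges_mono h) 1)

lemma WDgr.Walk.length_nonneg {G : WDgr} {i j : G.V} (p : G.Walk i j) : 0 ≤ p.length := by
  induction p with
  | nil => simp [WDgr.Walk.length]
  | cons e p ih =>
    have := G.w_pos ⟨_, e⟩
    simp only [WDgr.Walk.length]; linarith

lemma WDgr.nonneg_of_mem_filtEdges {G : WDgr} {t : ℝ} {τ} (h : τ ∈ G.filtEdges t) : 0 ≤ t := by
  have h1 : (0 : EReal) ≤ G.dist τ.1 τ.2 :=
    le_iInf fun p => le_iInf fun _ => by exact_mod_cast p.length_nonneg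
  exact_mod_cast h1.trans h.2

lemma regProj_single {V : Type} {p : ℕ} (x : Fin (p + 1) → V) (a : ℝ) (h : IsRegular x) :
    regProj V p (Finsupp.single x a) = Finsupp.single x a := by
  simp [regProj, Finsupp.linearCombination_single, h]

lemma regProj_single_of_not {V : Type} {p : ℕ} (x : Fin (p + 1) → V) (a : ℝ) (h : ¬ IsRegular x) :
    regProj V p (Finsupp.single x a) = 0 := by
  simp [regProj, Finsupp.linearCombination_single, h]

lemma boundary_edge {V : Type} (a b : V) (r : ℝ) :
    boundary V 0 (Finsupp.single ![a, b] r) = Finsupp.single ![b] r - Finsupp.single ![a] r := by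
  have h : nregBoundary V 0 (Finsupp.single ![a, b] r) =
      Finsupp.single ![b] r - Finsupp.single ![a] r := by
    rw [nregBoundary, Finsupp.linearCombination_single]
    have a0 : (fun j : Fin 1 => ![a, b] ((0 : Fin 2).succAbove j)) = ![b] := by
      funext j; fin_cases j; rfl
    have a1 : (fun j : Fin 1 => ![a, b] ((1 : Fin 2).succAbove j)) = ![a] := by
      funext j; fin_cases j; rfl
    refine (congrArg _ (Fin.sum_univ_two _)).trans ?_
    rw [a0, a1]
    simp [sub_eq_add_neg]
  rw [boundary, LinearMap.comp_apply, h, map_sub, regProj_single _ _ fun i => i.elim0,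
    regProj_single _ _ fun i => i.elim0]

lemma boundary_boundary_single {V : Type} (a b c : V) (hab : a ≠ b) (hbc : b ≠ c) :
    boundary V 0 (boundary V 1 (Finsupp.single ![a, b, c] 1)) = 0 := by
  have h : nregBoundary V 1 (Finsupp.single ![a, b, c] 1) =
      Finsupp.single ![b, c] 1 + Finsupp.single ![a, c] (-1) + Finsupp.single ![a, b] 1 := by
    rw [nregBoundary, Finsupp.linearCombination_single]
    have a0 : (fun j : Fin 2 => ![a, b, c] ((0 : Fin 3).succAbove j)) = ![b, c] := by
      funext j; fin_cases j <;> rfl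
    have a1 : (fun j : Fin 2 => ![a, b, c] ((1 : Fin 3).succAbove j)) = ![a, c] := by
      funext j; fin_cases j <;> rfl
    have a2 : (fun j : Fin 2 => ![a, b, c] ((2 : Fin 3).succAbove j)) = ![a, b] := by
      funext j; fin_cases j <;> rfl
    refine (congrArg _ (Fin.sum_univ_three _)).trans ?_
    rw [a0, a1, a2]
    simp
  have reg : ∀ x y : V, x ≠ y → IsRegular (p := 1) ![x, y] := fun x y hxy i => by
    fin_cases i; exact hxy
  change boundary V 0 (regProj V 1 (nregBoundary V 1 _)) = 0
  rw [h, map_add (regProj _ _), map_add (regProj _ _), regProj_single _ _ (reg _ _ hab),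
    regProj_single _ _ (reg _ _ hbc)]
  by_cases hac : a = c
  · subst hac
    rw [regProj_single_of_not _ _ fun h => h 0 rfl]
    simp [boundary_edge]
  · rw [regProj_single _ _ (reg _ _ hac)]
    simp only [map_add, boundary_edge]
    simp only [Finsupp.single_neg]
    abel

/-- Boundaries are cycles. -/
lemma WDgr.boundaries_le_cycles (G : WDgr) (t : ℝ) : G.boundaries t ≤ G.cycles t := by
  rintro _ ⟨c, hc, rfl⟩
  have hE : G.filtEdges t ⊆ G.groundedEdges t :=
    fun τ hτ => ⟨nonneg_of_mem_filtEdges hτ, .inr hτ⟩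
  refine ⟨⟨allowedChains_mono hE 1 hc.2,
    (Finsupp.mem_supported ℝ _).2 fun x _ i => i.elim0⟩, ?_⟩
  have hc1 : c ∈ Submodule.span ℝ ((fun x => Finsupp.single x (1 : ℝ)) ''
      {x : Fin 3 → G.V | IsAllowed (G.filtEdges t) x}) :=
    (Finsupp.supported_eq_span_single ℝ _).le hc.1
  refine (Submodule.span_le.2 ?_ : _ ≤ LinearMap.ker (boundary G.V 0 ∘ₗ boundary G.V 1)) hc1
  rintro _ ⟨x, hx, rfl⟩
  have hx' : x = ![x 0, x 1, x 2] := by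
    funext j; fin_cases j <;> rfl
  have h := boundary_boundary_single (x 0) (x 1) (x 2) (hx 0).1 (hx 1).1
  rw [← hx'] at h
  exact h

/-- The first grounded homology at time `t`: cycles modulo boundaries, realized as the space of
classes of cycles in the quotient of all `1`-chains by the boundaries (which are cycles). -/
def WDgr.homology (G : WDgr) (t : ℝ) : Submodule ℝ (Chains G.V 1 ⧸ G.boundaries t) :=
  (G.cycles t).map (G.boundaries t).mkQ

/-- The map on homology induced by the inclusion of the stage `s` into the stage `t`. -/
def WDgr.homologyMap (G : WDgr) {s t : ℝ} (h : s ≤ t) : G.homology s →ₗ[ℝ] G.homology t :=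
  ((G.boundaries s).mapQ (G.boundaries t) LinearMap.id (G.boundaries_mono h)).restrict (by
    rintro _ ⟨z, hz, rfl⟩
    exact ⟨z, G.cycles_mono h hz, rfl⟩)

/-- Grounded persistent path homology of a weighted digraph. -/
def WDgr.persHomology (G : WDgr) : PersVec where
  obj t := ModuleCat.of ℝ (G.homology t)
  map h := ModuleCat.ofHom (G.homologyMap h.le)
  map_id t := by
    apply ModuleCat.hom_ext
    ext ⟨_, z, hz, rfl⟩
    rfl
  map_comp f g := by
    apply ModuleCat.hom_ext
    ext ⟨_, z, hz, rfl⟩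
    rfl

/-! ### Interval modules and barcodes -/

/-- Non-empty intervals of the real line (of any kind, bounded or not). -/
def RealInterval : Type := {I : Set ℝ // I.OrdConnected ∧ I.Nonempty}

/-- The vector space `P(I)(t)`, which is `ℝ` if `t ∈ I` and `0` otherwise. -/
def intervalSpace (I : RealInterval) (t : ℝ) : Submodule ℝ ℝ where
  carrier := {x | t ∉ I.1 → x = 0}
  add_mem' ha hb h := by rw [ha h, hb h, add_zero]
  zero_mem' _ := rfl
  smul_mem' c x hx h := by rw [hx h, smul_zero]

open Classical in
/-- The map `P(I)(s ≤ t)`: the identity if `s` and `t` lie in `I`, and zero otherwise. -/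
def intervalMap (I : RealInterval) (s t : ℝ) : intervalSpace I s →ₗ[ℝ] intervalSpace I t :=
  if h : s ∈ I.1 ∧ t ∈ I.1 then
    (intervalSpace I s).subtype.codRestrict (intervalSpace I t) fun _ ht => absurd h.2 ht
  else 0

/-- The direct sum of a finite family of interval modules, formed pointwise. -/
def intervalSum {ι : Type} [Fintype ι] (I : ι → RealInterval) : PersVec where
  obj t := ModuleCat.of ℝ (∀ k, intervalSpace (I k) t)
  map {s t} _ := ModuleCat.ofHom (LinearMap.pi fun k => intervalMap (I k) s t ∘ₗ LinearMap.proj k)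
  map_id t := by
    apply ModuleCat.hom_ext
    ext x k
    by_cases h : t ∈ (I k).1
    · simp [intervalMap, h]
      rfl
    · simp [intervalMap, h, (x k).2 h]
  map_comp {s u t} f g := by
    apply ModuleCat.hom_ext
    ext x k
    by_cases hs : s ∈ (I k).1
    · by_cases ht : t ∈ (I k).1
      · have hu : u ∈ (I k).1 := (I k).2.1.out hs ht ⟨f.le, g.le⟩
        simp [intervalMap, hs, hu, ht]
        rfl
      · simp [intervalMap, ht]
    · simp [intervalMap, hs]

/-- A barcode with finitely many bars. -/
abbrev Barcode : Type := Multiset RealInterval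

open Classical in
/-- `B` is a barcode of `M`: the module `M` is isomorphic to the direct sum of the interval modules
of the elements of `B`, taken with multiplicity. -/
def IsBarcode (M : PersVec) (B : Barcode) : Prop :=
  Nonempty (M ≅ intervalSum fun k : B => k.1)

instance : Inhabited Barcode := ⟨0⟩

/-- The barcode of `M`: the multiset of intervals, unique when it exists, with `IsBarcode M B`. -/
def barcode (M : PersVec) : Barcode := Classical.epsilon (IsBarcode M)

/-- The barcode of the grounded persistent path homology of `G`. -/
def WDgr.barcode (G : WDgr) : Barcode := GrPPH.barcode G.persHomology

/-! ### Bottleneck distance -/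

/-- The pair of end points of an interval, possibly infinite. -/
def RealInterval.endpoints (I : RealInterval) : EReal × EReal :=
  (sInf ((fun x : ℝ => (x : EReal)) '' I.1), sSup ((fun x : ℝ => (x : EReal)) '' I.1))

open Classical in
/-- The distance `|x - y|` of extended reals; equal infinities have distance `0`. -/
def eDist (x y : EReal) : ENNReal := if x = y then 0 else (x - y).abs

/-- The supremum norm of `x - y` for points of the extended plane. -/
def pointDist (x y : EReal × EReal) : ENNReal := max (eDist x.1 y.1) (eDist x.2 y.2)

open Classical in
/-- The points of the diagram of `B` (with multiplicity) together with those of the diagonal. -/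
def diagramPoint (B : Barcode) : B ⊕ ℝ → EReal × EReal :=
  Sum.elim (fun k => k.1.endpoints) fun x => ((x : EReal), (x : EReal))

open Classical in
/-- The bottleneck distance of two barcodes. -/
def bottleneckDist (B₁ B₂ : Barcode) : ENNReal :=
  ⨅ γ : (B₁ ⊕ ℝ) ≃ (B₂ ⊕ ℝ), ⨆ x, pointDist (diagramPoint B₁ x) (diagramPoint B₂ (γ x))

/-! ### The explicit family -/

/-- The bar `[a, b)`. -/
def icoBar (a b : ℝ) (h : a < b) : RealInterval :=
  ⟨Set.Ico a b, Set.ordConnected_Ico, Set.nonempty_Ico.2 h⟩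

/-- The digraph on `v₀, v₁, v₂, v₃` with edges `v₀v₁`, `v₁v₃`, `v₂v₃` of weight `1` and an edge
`v₀v₂` of weight `W`. -/
def square (W : ℝ) (hW : 0 < W) : WDgr where
  V := Fin 4
  E := {(0, 1), (1, 3), (0, 2), (2, 3)}
  loopless i := by
    fin_cases i <;> simp
  w e := if e.1 = (0, 2) then W else 1
  w_pos e := by
    split_ifs
    · exact hW
    · exact one_pos

/-- The edge `v₁v₃` of `square W hW`. -/
def squareEdge (W : ℝ) (hW : 0 < W) : (square W hW).V × (square W hW).V :=
  ((1 : Fin 4), (3 : Fin 4))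

end GrPPH

end

noncomputable section

namespace GrPPH

open CategoryTheory

/-! The edge `v₀v₂` shares no vertex with `e = v₁v₃`, so its weight `W` is invisible in the
neighbourhood graph, while deleting `e` destroys a bar of length `W`. Letting `W` grow defeats every
`f`.

Every cycle on the square is a combination of the boundaries of the triangles `v₀v₁v₃` and `v₀v₂v₃`,
with a unique filling (`boundary_fillChain`). That filling is admissible in `Ω₂(G^t)` as soon as the
cycle itself is supported on `G^t` (`mem_boundary_of_squarePairs`). Homology thus only detects
cycles using an edge of `G` that has not yet entered `G^t`.

With `e` present, the cycle around the square exists from time `0` and uses `v₀v₂`, which enters at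
time `W`; the other cycles are filled on arrival, so the coefficient of `v₀v₂` identifies the
homology with the interval module of `[0, W)`. Without `e`, no cycle exists until `v₀v₃` appears at
time `W + 1`, when everything is already filled, so the homology vanishes. -/

/-! ### Barcodes of interval modules and of the zero module. -/

lemma intervalMap_apply_of_mem (I : RealInterval) {s t : ℝ} (hs : s ∈ I.1) (ht : t ∈ I.1)
    (x : intervalSpace I s) : ((intervalMap I s t x : intervalSpace I t) : ℝ) = x := by
  simp only [intervalMap, dif_pos (And.intro hs ht)]
  rfl

lemma intervalMap_of_not_mem (I : RealInterval) {s t : ℝ} (h : ¬ (s ∈ I.1 ∧ t ∈ I.1)) :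
    intervalMap I s t = 0 := by
  simp only [intervalMap, dif_neg h]

/-- The generator of the interval module at a point of the interval. -/
def intervalUnit (I : RealInterval) (t : ℝ) (ht : t ∈ I.1) : intervalSpace I t :=
  ⟨1, fun h => absurd ht h⟩

lemma intervalUnit_ne_zero (I : RealInterval) (t : ℝ) (ht : t ∈ I.1) :
    intervalUnit I t ht ≠ 0 := fun h => one_ne_zero (congrArg Subtype.val h)

lemma intervalSpace_eq_zero {I : RealInterval} {t : ℝ} (ht : t ∉ I.1) (x : intervalSpace I t) :
    x = 0 := Subtype.ext (x.2 ht)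

open Classical in
lemma coe_eq_of_singleton {J : RealInterval} (k : ({J} : Barcode)) : k.1 = J :=
  Multiset.mem_singleton.1 (Multiset.coe_mem (x := k))

open Classical in
lemma card_toType (B : Barcode) : Fintype.card B = Multiset.card B := Multiset.card_coe B

/-- A family of coordinates identifying a persistent vector space with an interval module. -/
structure IntervalCoordinate (M : PersVec) (J : RealInterval) where
  coord : ∀ t, M.obj t →ₗ[ℝ] ℝ
  subsingleton : ∀ t, t ∉ J.1 → Subsingleton (M.obj t)
  bijective : ∀ t, t ∈ J.1 → Function.Bijective (coord t)
  naturality : ∀ {s t : ℝ} (f : s ⟶ t), s ∈ J.1 → t ∈ J.1 → ∀ x : M.obj s,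
    coord t (M.map f x) = coord s x

open Classical in
lemma IntervalCoordinate.isBarcode {M : PersVec} {J : RealInterval} (φ : IntervalCoordinate M J) :
    IsBarcode M {J} := by
  have hcard : Fintype.card ({J} : Barcode) = 1 := by rw [card_toType]; rfl
  obtain ⟨k₀, hk₀⟩ := Fintype.card_eq_one_iff.1 hcard
  have hz : ∀ (k : ({J} : Barcode)) (t : ℝ) (x : M.obj t), t ∉ k.1.1 → φ.coord t x = 0 := by
    intro k t x ht
    rw [coe_eq_of_singleton k] at ht
    have := φ.subsingleton t ht
    rw [Subsingleton.elim x 0, map_zero]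
  let f : ∀ t, M.obj t →ₗ[ℝ] (∀ k : ({J} : Barcode), intervalSpace k.1 t) := fun t =>
    LinearMap.pi fun k => (φ.coord t).codRestrict (intervalSpace k.1 t) fun x => hz k t x
  have hf : ∀ t x k, ((f t x k : intervalSpace _ t) : ℝ) = φ.coord t x := fun _ _ _ => rfl
  have hbij : ∀ t, Function.Bijective (f t) := by
    intro t
    by_cases ht : t ∈ J.1
    · refine ⟨fun x y h => (φ.bijective t ht).1 ?_, fun y => ?_⟩
      · rw [← hf t x k₀, ← hf t y k₀, h]
      · obtain ⟨x, hx⟩ := (φ.bijective t ht).2 (y k₀)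
        refine ⟨x, ?_⟩
        funext k
        obtain rfl := hk₀ k
        exact Subtype.ext hx
    · have := φ.subsingleton t ht
      refine ⟨fun x y _ => Subsingleton.elim _ _, fun y => ⟨0, ?_⟩⟩
      funext k
      rw [intervalSpace_eq_zero (by rwa [coe_eq_of_singleton k]) (y k),
        intervalSpace_eq_zero (by rwa [coe_eq_of_singleton k]) (f t 0 k)]
  refine ⟨NatIso.ofComponents (fun t => (LinearEquiv.ofBijective (f t) (hbij t)).toModuleIso) ?_⟩
  intro s t g
  apply ModuleCat.hom_ext
  ext x : 1
  change f t (M.map g x) = fun k => intervalMap k.1 s t (f s x k)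
  funext k
  apply Subtype.ext
  rw [hf]
  have hJ := coe_eq_of_singleton k
  by_cases h : s ∈ k.1.1 ∧ t ∈ k.1.1
  · rw [intervalMap_apply_of_mem _ h.1 h.2, hf]
    rw [hJ] at h
    exact φ.naturality g h.1 h.2 x
  · rw [intervalMap_of_not_mem _ h, LinearMap.zero_apply]
    by_cases ht : t ∈ k.1.1
    · have hs : s ∉ J.1 := fun hs => h ⟨by rwa [hJ], ht⟩
      have := φ.subsingleton s hs
      rw [Subsingleton.elim x 0, map_zero, map_zero]; rfl
    · exact hz k t _ ht

open Classical in
-- Stages have dimension at most one, so the bars of `B` are disjoint and lie in `J`. The structure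
-- maps inside `J` are nonzero, so any two points of `J` lie in a common bar.
lemma IntervalCoordinate.eq_singleton {M : PersVec} {J : RealInterval}
    (φ : IntervalCoordinate M J) {B : Barcode} (hB : IsBarcode M B) : B = {J} := by
  obtain ⟨α⟩ := hB
  let e : ∀ t, M.obj t ≃ₗ[ℝ] (∀ k : B, intervalSpace k.1 t) := fun t => (α.app t).toLinearEquiv
  have he : ∀ {s t : ℝ} (g : s ⟶ t) (x : M.obj s) (k : B),
      e t (M.map g x) k = intervalMap k.1 s t (e s x k) := fun g x k =>
    congrFun (congrArg (fun h => h.hom x) (α.hom.naturality g)) k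
  let u : ∀ (k : B) (t : ℝ), t ∈ k.1.1 → ∀ k : B, intervalSpace k.1 t := fun k t ht =>
    Pi.single k (intervalUnit k.1 t ht)
  have hu : ∀ k t ht, u k t ht k ≠ 0 := fun k t ht => by
    rw [show u k t ht k = intervalUnit k.1 t ht from Pi.single_eq_same _ _]
    exact intervalUnit_ne_zero _ _ _
  have hsub : ∀ (k : B) t, t ∈ k.1.1 → t ∈ J.1 := by
    intro k t ht
    by_contra hJ
    have := φ.subsingleton t hJ
    have h0 : u k t ht = 0 := (e t).symm.injective (Subsingleton.elim _ _)
    exact hu k t ht (congrFun h0 k)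
  have huniq : ∀ (k k' : B) t, t ∈ k.1.1 → t ∈ k'.1.1 → k = k' := by
    intro k k' t hk hk'
    by_contra hne
    have hinj : Function.Injective fun x => φ.coord t ((e t).symm x) :=
      (φ.bijective t (hsub k t hk)).1.comp (e t).symm.injective
    set a := φ.coord t ((e t).symm (u k t hk)) with ha
    set b := φ.coord t ((e t).symm (u k' t hk')) with hb
    -- Two vectors of a line with coordinates `a` and `b` satisfy this relation, but generators of
    -- distinct bars are independent.
    have hab : b • u k t hk = a • u k' t hk' := hinj (by
      simp only [map_smul, smul_eq_mul, ← ha, ← hb]; ring)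
    have h1 := congrFun hab k
    have h2 : u k' t hk' k = 0 := Pi.single_eq_of_ne hne _
    rw [Pi.smul_apply, Pi.smul_apply, h2, smul_zero, smul_eq_zero] at h1
    have hb0 : b = 0 := h1.resolve_right (hu k t hk)
    have h3 : u k' t hk' = 0 := hinj (by
      change φ.coord t ((e t).symm (u k' t hk')) = φ.coord t ((e t).symm 0)
      rw [← hb, hb0, map_zero, map_zero])
    exact hu k' t hk' (congrFun h3 k')
  have hex : ∀ s t, s ≤ t → s ∈ J.1 → t ∈ J.1 → ∃ k : B, s ∈ k.1.1 ∧ t ∈ k.1.1 := by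
    intro s t hst hs ht
    -- With no bar through both points the map from `s` to `t` would vanish, yet it preserves the
    -- coordinate `1`.
    by_contra! hcon
    obtain ⟨x, hx⟩ := (φ.bijective s hs).2 1
    have hy := φ.naturality (homOfLE hst) hs ht x
    have h0 : e t (M.map (homOfLE hst) x) = 0 := by
      funext k
      rw [he, intervalMap_of_not_mem _ fun h => hcon k h.1 h.2]
      rfl
    rw [(e t).map_eq_zero_iff.1 h0, map_zero, hx] at hy
    exact zero_ne_one hy
  obtain ⟨s₀, hs₀⟩ := J.2.2
  obtain ⟨k₀, hk₀, -⟩ := hex s₀ s₀ le_rfl hs₀ hs₀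
  have hJ : ∀ t, t ∈ J.1 → t ∈ k₀.1.1 := by
    intro t ht
    rcases le_total s₀ t with h | h
    · obtain ⟨k, h1, h2⟩ := hex _ _ h hs₀ ht
      rwa [huniq k₀ k s₀ hk₀ h1]
    · obtain ⟨k, h1, h2⟩ := hex _ _ h ht hs₀
      rwa [huniq k₀ k s₀ hk₀ h2]
  have hk₀J : k₀.1 = J := Subtype.ext (Set.Subset.antisymm (hsub k₀) hJ)
  have hcard : Multiset.card B = 1 := by
    rw [← card_toType, Fintype.card_eq_one_iff]
    refine ⟨k₀, fun k => ?_⟩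
    obtain ⟨t, ht⟩ := k.1.2.2
    exact huniq k k₀ t ht (hJ t (hsub k t ht))
  obtain ⟨I, rfl⟩ := Multiset.card_eq_one.1 hcard
  rw [← hk₀J, coe_eq_of_singleton k₀]

lemma IntervalCoordinate.isBarcode_iff {M : PersVec} {J : RealInterval}
    (φ : IntervalCoordinate M J) (B : Barcode) : IsBarcode M B ↔ B = {J} :=
  ⟨φ.eq_singleton, fun h => h ▸ φ.isBarcode⟩

open Classical in
lemma isBarcode_iff_of_subsingleton {M : PersVec} (hM : ∀ t, Subsingleton (M.obj t))
    (B : Barcode) : IsBarcode M B ↔ B = 0 := by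
  constructor
  · rintro ⟨α⟩
    by_contra hB
    have : Nonempty B := by
      rw [← Fintype.card_pos_iff, card_toType, Multiset.card_pos]
      exact hB
    obtain ⟨k⟩ := this
    obtain ⟨t, ht⟩ := k.1.2.2
    let e : M.obj t ≃ₗ[ℝ] (∀ k : B, intervalSpace k.1 t) := (α.app t).toLinearEquiv
    have := hM t
    have h0 : (Pi.single k (intervalUnit k.1 t ht) : ∀ k : B, intervalSpace k.1 t) = 0 :=
      e.symm.injective (Subsingleton.elim _ _)
    have h1 := congrFun h0 k
    rw [Pi.single_eq_same] at h1
    exact intervalUnit_ne_zero _ _ _ h1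
  · rintro rfl
    have hE : IsEmpty (0 : Barcode) := by
      rw [← Fintype.card_eq_zero_iff, card_toType]; rfl
    have hbij : ∀ t, Function.Bijective
        (0 : M.obj t →ₗ[ℝ] (∀ k : (0 : Barcode), intervalSpace k.1 t)) := fun t => by
      have := hM t
      exact ⟨fun x y _ => Subsingleton.elim _ _, fun y => ⟨0, funext fun k => hE.elim k⟩⟩
    refine ⟨NatIso.ofComponents (fun t => (LinearEquiv.ofBijective _ (hbij t)).toModuleIso) ?_⟩
    intro s t g
    apply ModuleCat.hom_ext
    ext x : 1
    exact funext fun k => hE.elim k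

/-- The choice made by `Classical.epsilon` is determined only by existence together with uniqueness,
hence the equivalence as hypothesis. -/
lemma barcode_eq {M : PersVec} {B : Barcode} (h : ∀ B', IsBarcode M B' ↔ B' = B) :
    barcode M = B :=
  (h _).1 (Classical.epsilon_spec ⟨B, (h B).2 rfl⟩)

/-! ### Bottleneck distance from one bar to the empty barcode. -/

lemma endpoints_icoBar (a b : ℝ) (h : a < b) : (icoBar a b h).endpoints = ((a : EReal), (b : EReal)) := by
  have himg : (fun x : ℝ => (x : EReal)) '' Set.Ico a b = Set.Ico (a : EReal) b := by
    ext x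
    constructor
    · rintro ⟨y, hy, rfl⟩
      exact ⟨EReal.coe_le_coe_iff.2 hy.1, EReal.coe_lt_coe_iff.2 hy.2⟩
    · intro hx
      lift x to ℝ using ⟨(hx.2.trans (EReal.coe_lt_top b)).ne,
        ((EReal.bot_lt_coe a).trans_le hx.1).ne'⟩
      exact ⟨x, ⟨EReal.coe_le_coe_iff.1 hx.1, EReal.coe_lt_coe_iff.1 hx.2⟩, rfl⟩
  have hlt : (a : EReal) < b := EReal.coe_lt_coe_iff.2 h
  simp only [RealInterval.endpoints, icoBar, himg]
  rw [csInf_Ico hlt, csSup_Ico hlt]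

lemma eDist_coe (x y : ℝ) : eDist (x : EReal) (y : EReal) = ENNReal.ofReal |x - y| := by
  unfold eDist
  split_ifs with h
  · rw [EReal.coe_eq_coe_iff.1 h]; simp
  · rw [← EReal.coe_sub, EReal.abs_def]

/-- The map inserting one new point at `c` into the real line, by moving the positive multiples of
`c` one step up. -/
def insertPoint (c : ℝ) : Option ℝ → ℝ
  | none => c
  | some x => open Classical in if ∃ n : ℕ, x = c * (n + 1) then x + c else x

/-- Hilbert's hotel: `c, 2c, 3c, …` move up one place, which vacates exactly `c`. -/
lemma insertPoint_bijective {c : ℝ} (hc : 0 < c) : Function.Bijective (insertPoint c) := by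
  have hinj : ∀ {m n : ℕ}, c * (m + 1) = c * (n + 1) → m = n := fun h => by
    have := mul_left_cancel₀ hc.ne' h
    exact_mod_cast add_right_cancel this
  constructor
  · rintro (_ | x) (_ | y) h
    · rfl
    · simp only [insertPoint] at h
      split_ifs at h with hy
      · obtain ⟨n, rfl⟩ := hy
        have : (0 : ℝ) ≤ n := n.cast_nonneg
        nlinarith
      · exact absurd ⟨0, by rw [← h]; simp⟩ hy
    · simp only [insertPoint] at h
      split_ifs at h with hx
      · obtain ⟨n, rfl⟩ := hx
        have : (0 : ℝ) ≤ n := n.cast_nonneg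
        nlinarith
      · exact absurd ⟨0, by rw [h]; simp⟩ hx
    · simp only [insertPoint] at h
      split_ifs at h with hx hy hy
      · rw [add_right_cancel h]
      · obtain ⟨n, rfl⟩ := hx
        exact absurd ⟨n + 1, by rw [← h]; push_cast; ring⟩ hy
      · obtain ⟨n, rfl⟩ := hy
        exact absurd ⟨n + 1, by rw [h]; push_cast; ring⟩ hx
      · rw [h]
  · intro y
    by_cases hy : ∃ n : ℕ, y = c * (n + 1)
    · obtain ⟨n | n, rfl⟩ := hy
      · exact ⟨none, by simp [insertPoint]⟩
      · refine ⟨some (c * (n + 1)), ?_⟩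
        rw [insertPoint, if_pos ⟨n, rfl⟩]
        push_cast; ring
    · exact ⟨some y, by rw [insertPoint, if_neg hy]⟩

lemma abs_insertPoint_sub_le {c : ℝ} (hc : 0 < c) (x : ℝ) : |x - insertPoint c (some x)| ≤ c := by
  rw [insertPoint]
  split_ifs
  · simp [abs_of_pos hc]
  · simpa using hc.le

open Classical in
lemma bottleneckDist_icoBar_zero (W : ℝ) (hW : 0 < W) :
    bottleneckDist {icoBar 0 W hW} 0 = ENNReal.ofReal (W / 2) := by
  have hE : IsEmpty (0 : Barcode) := by
    rw [← Fintype.card_eq_zero_iff, card_toType]; rfl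
  have hcard : Fintype.card ({icoBar 0 W hW} : Barcode) = 1 := by rw [card_toType]; rfl
  obtain ⟨k₀, hk₀⟩ := Fintype.card_eq_one_iff.1 hcard
  have hend : ∀ k : ({icoBar 0 W hW} : Barcode),
      diagramPoint {icoBar 0 W hW} (Sum.inl k) = (((0 : ℝ) : EReal), (W : EReal)) := fun k => by
    change k.1.endpoints = _
    rw [coe_eq_of_singleton k, endpoints_icoBar]
  have hdiag : ∀ (B : Barcode) (x : ℝ),
    diagramPoint B (Sum.inr x) = ((x : EReal), (x : EReal)) := fun _ _ => rfl
  refine le_antisymm ?_ (le_iInf fun γ => ?_)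
  · have hhalf : 0 < W / 2 := half_pos hW
    let U : Unique ({icoBar 0 W hW} : Barcode) := ⟨⟨k₀⟩, hk₀⟩
    -- Each diagonal point occurs only once, so sending the bar to the midpoint `W / 2` displaces a
    -- point. The shift by `W / 2` makes room at no extra cost.
    let γ : ({icoBar 0 W hW} : Barcode) ⊕ ℝ ≃ (0 : Barcode) ⊕ ℝ :=
      ((Equiv.sumCongr (Equiv.ofUnique _ PUnit.{1}) (Equiv.refl ℝ)).trans
        ((Equiv.sumComm _ _).trans (Equiv.optionEquivSumPUnit ℝ).symm)).trans
        ((Equiv.ofBijective _ (insertPoint_bijective hhalf)).trans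
          (Equiv.emptySum (0 : Barcode) ℝ).symm)
    refine (iInf_le _ γ).trans (iSup_le ?_)
    rintro (k | x)
    · have hγ : γ (Sum.inl k) = Sum.inr (W / 2) := rfl
      rw [hγ, hend, hdiag, pointDist, eDist_coe, eDist_coe]
      refine max_le (ENNReal.ofReal_le_ofReal ?_) (ENNReal.ofReal_le_ofReal ?_)
      · rw [zero_sub, abs_neg, abs_of_pos hhalf]
      · rw [abs_of_pos (by linarith)]; linarith
    · have hγ : γ (Sum.inr x) = Sum.inr (insertPoint (W / 2) (some x)) := rfl
      rw [hγ, hdiag, hdiag, pointDist, eDist_coe, max_self]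
      exact ENNReal.ofReal_le_ofReal (abs_insertPoint_sub_le hhalf x)
  · refine le_trans ?_ (le_iSup _ (Sum.inl k₀))
    rcases γ (Sum.inl k₀) with k | x
    · exact hE.elim k
    · rw [hend, hdiag, pointDist, eDist_coe, eDist_coe, le_max_iff]
      -- The bar must be matched to a diagonal point `x`, which is at distance at least `W / 2` from
      -- `0` or from `W`.
      rcases le_total (W / 2) x with h | h
      · exact .inl (ENNReal.ofReal_le_ofReal (h.trans (by rw [zero_sub, abs_neg]; exact le_abs_self x)))
      · exact .inr (ENNReal.ofReal_le_ofReal (le_trans (by linarith) (le_abs_self _)))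

/-! ### Shortest-path filtration -/

lemma WDgr.mem_filtEdges_of_edge {G : WDgr} {i j : G.V} (h : (i, j) ∈ G.E) {t : ℝ}
    (ht : G.w ⟨_, h⟩ ≤ t) : (i, j) ∈ G.filtEdges t := by
  have hij : i ≠ j := fun hij => G.loopless j (hij ▸ h)
  refine ⟨hij, ?_⟩
  have hp : (WDgr.Walk.cons h (.nil j)).IsPath := by
    simp [WDgr.Walk.IsPath, WDgr.Walk.support, hij]
  refine (iInf₂_le _ hp).trans (EReal.coe_le_coe_iff.2 ?_)
  simpa [WDgr.Walk.length] using ht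

lemma WDgr.exists_walk_of_mem_filtEdges {G : WDgr} {i j : G.V} {t : ℝ}
    (h : (i, j) ∈ G.filtEdges t) : Nonempty (G.Walk i j) := by
  by_contra hne
  rw [not_nonempty_iff] at hne
  have h2 : G.dist i j = ⊤ := by rw [WDgr.dist, iInf_of_empty]
  have h3 := h.2
  simp only [h2, top_le_iff] at h3
  exact EReal.coe_ne_top t h3

/-- Asking for the bound on all walks, not just paths, permits plain induction on walks. -/
lemma WDgr.le_of_mem_filtEdges {G : WDgr} {i j : G.V} {t L : ℝ} (h : (i, j) ∈ G.filtEdges t)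
    (hL : ∀ p : G.Walk i j, L ≤ p.length) : L ≤ t :=
  EReal.coe_le_coe_iff.1 ((le_iInf₂ fun p _ => EReal.coe_le_coe_iff.2 (hL p)).trans h.2)

lemma WDgr.subsingleton_homology {G : WDgr} {t : ℝ} (h : G.cycles t ≤ G.boundaries t) :
    Subsingleton (G.homology t) := by
  have h0 : G.homology t = ⊥ := by
    rw [WDgr.homology, eq_bot_iff, Submodule.map_le_iff_le_comap]
    exact fun c hc => (Submodule.Quotient.mk_eq_zero _).2 (h hc)
  rw [h0]
  infer_instance

lemma pair_mem_of_mem_allowedChains {V : Type} {F : Set (V × V)} {c : Chains V 1}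
    (hc : c ∈ allowedChains F 1) {x : Fin 2 → V} (hx : c x ≠ 0) : (x 0, x 1) ∈ F :=
  (Finsupp.mem_supported ℝ c).1 hc (Finsupp.mem_support_iff.2 hx) 0

lemma isAllowed_edge {V : Type} {F : Set (V × V)} {x : Fin 2 → V} (h : (x 0, x 1) ∈ F) :
    IsAllowed (p := 1) F x := fun i => by fin_cases i; exact h

lemma isAllowed_triple {V : Type} {F : Set (V × V)} {a b c : V} (h : (a, b) ∈ F)
    (h' : (b, c) ∈ F) : IsAllowed (p := 2) F ![a, b, c] := fun i => by
  fin_cases i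
  · exact h
  · exact h'

/-- Distinctness of `a` and `c` keeps the middle face regular, so the projection removes nothing. -/
lemma boundary_triple {V : Type} {a b c : V} (hab : a ≠ b) (hbc : b ≠ c) (hac : a ≠ c) (r : ℝ) :
    boundary V 1 (Finsupp.single ![a, b, c] r) =
      Finsupp.single ![b, c] r - Finsupp.single ![a, c] r + Finsupp.single ![a, b] r := by
  have h : nregBoundary V 1 (Finsupp.single ![a, b, c] r) =
      Finsupp.single ![b, c] r + Finsupp.single ![a, c] (-r) + Finsupp.single ![a, b] r := by
    rw [nregBoundary, Finsupp.linearCombination_single]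
    have a0 : (fun j : Fin 2 => ![a, b, c] ((0 : Fin 3).succAbove j)) = ![b, c] := by
      funext j; fin_cases j <;> rfl
    have a1 : (fun j : Fin 2 => ![a, b, c] ((1 : Fin 3).succAbove j)) = ![a, c] := by
      funext j; fin_cases j <;> rfl
    have a2 : (fun j : Fin 2 => ![a, b, c] ((2 : Fin 3).succAbove j)) = ![a, b] := by
      funext j; fin_cases j <;> rfl
    refine (congrArg _ (Fin.sum_univ_three _)).trans ?_
    rw [a0, a1, a2]
    simp
  have reg : ∀ x y : V, x ≠ y → IsRegular (p := 1) ![x, y] := fun x y hxy i => by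
    fin_cases i; exact hxy
  rw [boundary, LinearMap.comp_apply, h, map_add, map_add, regProj_single _ _ (reg _ _ hab),
    regProj_single _ _ (reg _ _ hbc), regProj_single _ _ (reg _ _ hac), Finsupp.single_neg]
  abel

/-! ### Cycles on the square -/

/-- The pairs of vertices joined by a directed path in the square. -/
def squarePairs : Set (Fin 4 × Fin 4) := {(0, 1), (1, 3), (0, 2), (2, 3), (0, 3)}

/-- A `2`-chain bounding a cycle supported on the square. -/
def fillChain (c : Chains (Fin 4) 1) : Chains (Fin 4) 2 :=
  Finsupp.single ![0, 1, 3] (c ![0, 1]) + Finsupp.single ![0, 2, 3] (c ![0, 2])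

lemma eq_sum_of_squarePairs {c : Chains (Fin 4) 1} (hc : c ∈ allowedChains squarePairs 1) :
    c = Finsupp.single ![0, 1] (c ![0, 1]) + Finsupp.single ![1, 3] (c ![1, 3]) +
      Finsupp.single ![0, 2] (c ![0, 2]) + Finsupp.single ![2, 3] (c ![2, 3]) +
      Finsupp.single ![0, 3] (c ![0, 3]) := by
  ext x
  obtain ⟨a, b, rfl⟩ : ∃ a b, x = ![a, b] := ⟨x 0, x 1, by funext j; fin_cases j <;> rfl⟩
  by_cases h : (a, b) ∈ squarePairs
  · simp only [squarePairs, Set.mem_insert_iff, Set.mem_singleton_iff, Prod.mk.injEq] at h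
    rcases h with ⟨rfl, rfl⟩ | ⟨rfl, rfl⟩ | ⟨rfl, rfl⟩ | ⟨rfl, rfl⟩ | ⟨rfl, rfl⟩ <;>
      simp
  · have h0 : c ![a, b] = 0 := by
      by_contra h0
      exact h (pair_mem_of_mem_allowedChains hc h0)
    simp only [squarePairs, Set.mem_insert_iff, Set.mem_singleton_iff, Prod.mk.injEq,
      not_or] at h
    rw [h0]
    simp only [Finsupp.add_apply, Finsupp.single_apply]
    simp [Matrix.vecCons_inj, eq_comm (b := a), eq_comm (b := b), h]

/-- These are the equations of `∂c = 0` at `v₁`, `v₂` and `v₀`; the one at `v₃` is redundant. -/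
lemma cycle_coefficients {c : Chains (Fin 4) 1} (hc : c ∈ allowedChains squarePairs 1)
    (h : boundary (Fin 4) 0 c = 0) : c ![1, 3] = c ![0, 1] ∧ c ![2, 3] = c ![0, 2] ∧
      c ![0, 3] = -c ![0, 1] - c ![0, 2] := by
  rw [eq_sum_of_squarePairs hc] at h
  simp only [map_add, boundary_edge] at h
  have h0 := DFunLike.congr_fun h ![0]
  have h1 := DFunLike.congr_fun h ![1]
  have h2 := DFunLike.congr_fun h ![2]
  simp at h0 h1 h2
  refine ⟨by linarith, by linarith, by linarith⟩

lemma boundary_fillChain {c : Chains (Fin 4) 1} (hc : c ∈ allowedChains squarePairs 1)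
    (h : boundary (Fin 4) 0 c = 0) : boundary (Fin 4) 1 (fillChain c) = c := by
  obtain ⟨h1, h2, h3⟩ := cycle_coefficients hc h
  conv_rhs => rw [eq_sum_of_squarePairs hc]
  rw [fillChain, map_add, boundary_triple (by decide) (by decide) (by decide),
    boundary_triple (by decide) (by decide) (by decide), h1, h2, h3, Finsupp.single_sub,
    Finsupp.single_neg]
  abel

/-- Both legs of each triangle carry the same coefficient in `c`, so a triangle occurring in
`fillChain c` has its legs in `E`. The diagonal `v₀v₃` need not lie in `E`: invariance only asks
that the total boundary `c` be allowed. -/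
lemma mem_boundary_of_squarePairs {E : Set (Fin 4 × Fin 4)} {c : Chains (Fin 4) 1}
    (hc : c ∈ allowedChains squarePairs 1) (h : boundary (Fin 4) 0 c = 0)
    (hE : c ∈ allowedChains E 1) :
    c ∈ (omegaSucc E 1).map (boundary (Fin 4) 1) := by
  obtain ⟨h1, h2, h3⟩ := cycle_coefficients hc h
  refine ⟨fillChain c, ⟨?_, ?_⟩, boundary_fillChain hc h⟩
  · refine Submodule.add_mem _ ?_ ?_
    · by_cases h0 : c ![0, 1] = 0
      · rw [h0, Finsupp.single_zero]; exact Submodule.zero_mem _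
      · exact Finsupp.single_mem_supported ℝ _ (isAllowed_triple
          (pair_mem_of_mem_allowedChains hE h0)
          (pair_mem_of_mem_allowedChains hE (x := ![1, 3]) (by rwa [h1])))
    · by_cases h0 : c ![0, 2] = 0
      · rw [h0, Finsupp.single_zero]; exact Submodule.zero_mem _
      · exact Finsupp.single_mem_supported ℝ _ (isAllowed_triple
          (pair_mem_of_mem_allowedChains hE h0)
          (pair_mem_of_mem_allowedChains hE (x := ![2, 3]) (by rwa [h2])))
  · rw [SetLike.mem_coe, Submodule.mem_comap, boundary_fillChain hc h]
    exact hE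

/-! ### The square -/

/-- The lengths of the walks in the square from `i` to `j` are bounded below as follows. -/
def SquareBound (W : ℝ) (i j : Fin 4) (l : ℝ) : Prop :=
  i = j ∨ (i = 0 ∧ j = 1 ∨ i = 1 ∧ j = 3 ∨ i = 2 ∧ j = 3) ∧ 1 ≤ l ∨
    (i = 0 ∧ j = 2) ∧ W ≤ l ∨ (i = 0 ∧ j = 3) ∧ 2 ≤ l

/-- The analogue of `SquareBound` after deletion of the edge `v₁v₃`. -/
def SquareDeleteBound (W : ℝ) (i j : Fin 4) (l : ℝ) : Prop :=
  i = j ∨ (i = 0 ∧ j = 1 ∨ i = 2 ∧ j = 3) ∧ 1 ≤ l ∨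
    (i = 0 ∧ j = 2) ∧ W ≤ l ∨ (i = 0 ∧ j = 3) ∧ W + 1 ≤ l

/-- The assumption `1 ≤ W` serves the walk through `v₂`, whose length `W + 1` must be at least `2`.
-/
lemma SquareBound.cons {W : ℝ} (hW : 1 ≤ W) {i j k : Fin 4} {l : ℝ} (hl : 0 ≤ l)
    (e : (i, j) = (0, 1) ∨ (i, j) = (1, 3) ∨ (i, j) = (0, 2) ∨ (i, j) = (2, 3))
    (h : SquareBound W j k l) :
    SquareBound W i k ((if (i, j) = (0, 2) then W else 1) + l) := by
  rcases e with e | e | e | e <;> obtain ⟨rfl, rfl⟩ := Prod.mk.inj e <;>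
    rcases h with rfl | ⟨⟨h, rfl⟩ | ⟨h, rfl⟩ | ⟨h, rfl⟩, h'⟩ | ⟨⟨h, rfl⟩, h'⟩ | ⟨⟨h, rfl⟩, h'⟩ <;>
    (try simp at h) <;> simp [SquareBound] <;> linarith

lemma SquareDeleteBound.cons {W : ℝ} {i j k : Fin 4} {l : ℝ} (hl : 0 ≤ l)
    (e : (i, j) = (0, 1) ∨ (i, j) = (1, 3) ∨ (i, j) = (0, 2) ∨ (i, j) = (2, 3))
    (e' : (i, j) ≠ (1, 3)) (h : SquareDeleteBound W j k l) :
    SquareDeleteBound W i k ((if (i, j) = (0, 2) then W else 1) + l) := by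
  rcases e with e | e | e | e <;> obtain ⟨rfl, rfl⟩ := Prod.mk.inj e <;>
    [skip; exact absurd rfl e'; skip; skip] <;>
    rcases h with rfl | ⟨⟨h, rfl⟩ | ⟨h, rfl⟩, h'⟩ | ⟨⟨h, rfl⟩, h'⟩ | ⟨⟨h, rfl⟩, h'⟩ <;>
    (try simp at h) <;> simp [SquareDeleteBound] <;> linarith

lemma square_walk {W : ℝ} {hW : 0 < W} (h1 : 1 ≤ W) {i j : (square W hW).V}
    (p : (square W hW).Walk i j) : SquareBound W i j p.length := by
  induction p with
  | nil i => exact .inl rfl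
  | cons e p ih => exact ih.cons h1 p.length_nonneg e

lemma square_delete_walk {W : ℝ} {hW : 0 < W}
    {i j : ((square W hW).deleteEdge (squareEdge W hW)).V}
    (p : ((square W hW).deleteEdge (squareEdge W hW)).Walk i j) :
    SquareDeleteBound W i j p.length := by
  induction p with
  | nil i => exact .inl rfl
  | cons e p ih => exact ih.cons p.length_nonneg e.1 e.2

lemma squarePairs_of_square_filtEdges {W : ℝ} {hW : 0 < W} (h1 : 1 ≤ W) {t : ℝ} :
    (square W hW).filtEdges t ⊆ squarePairs := by
  rintro ⟨i, j⟩ h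
  obtain ⟨p⟩ := WDgr.exists_walk_of_mem_filtEdges h
  have hne : i ≠ j := h.1
  rcases square_walk h1 p with h | ⟨⟨rfl, rfl⟩ | ⟨rfl, rfl⟩ | ⟨rfl, rfl⟩, -⟩ | ⟨⟨rfl, rfl⟩, -⟩ | ⟨⟨rfl, rfl⟩, -⟩
  · exact absurd h hne
  exacts [.inl rfl, .inr (.inl rfl), .inr (.inr (.inr (.inl rfl))), .inr (.inr (.inl rfl)),
    .inr (.inr (.inr (.inr rfl)))]

lemma squarePairs_of_square_delete_filtEdges {W : ℝ} {hW : 0 < W} {t : ℝ} {i j : Fin 4}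
    (h : (i, j) ∈ ((square W hW).deleteEdge (squareEdge W hW)).filtEdges t) :
    (i, j) ∈ squarePairs ∧ (i, j) ≠ (1, 3) := by
  obtain ⟨p⟩ := WDgr.exists_walk_of_mem_filtEdges h
  have hne : i ≠ j := h.1
  rcases square_delete_walk p with h | ⟨⟨rfl, rfl⟩ | ⟨rfl, rfl⟩, -⟩ | ⟨⟨rfl, rfl⟩, -⟩ | ⟨⟨rfl, rfl⟩, -⟩
  · exact absurd h hne
  exacts [⟨.inl rfl, by simp⟩, ⟨.inr (.inr (.inr (.inl rfl))), by simp⟩,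
    ⟨.inr (.inr (.inl rfl)), by simp⟩, ⟨.inr (.inr (.inr (.inr rfl))), by simp⟩]

lemma squarePairs_of_square_edge {W : ℝ} {hW : 0 < W} : (square W hW).E ⊆ squarePairs := by
  rintro _ (h | h | h | h)
  exacts [.inl h, .inr (.inl h), .inr (.inr (.inl h)), .inr (.inr (.inr (.inl h)))]

lemma zero_three_notMem_square {W : ℝ} {hW : 0 < W} :
    ((0 : Fin 4), (3 : Fin 4)) ∉ (square W hW).E := by
  change ((0 : Fin 4), (3 : Fin 4)) ∉
    ({(0, 1), (1, 3), (0, 2), (2, 3)} : Set (Fin 4 × Fin 4))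
  simp

lemma le_of_zero_two_mem_filtEdges {W : ℝ} {hW : 0 < W} (h1 : 1 ≤ W) {t : ℝ}
    (h : ((0 : Fin 4), (2 : Fin 4)) ∈ (square W hW).filtEdges t) : W ≤ t := by
  refine WDgr.le_of_mem_filtEdges h fun p => ?_
  have := square_walk h1 p
  simpa [SquareBound] using this

lemma two_le_of_zero_three_mem_filtEdges {W : ℝ} {hW : 0 < W} (h1 : 1 ≤ W) {t : ℝ}
    (h : ((0 : Fin 4), (3 : Fin 4)) ∈ (square W hW).filtEdges t) : 2 ≤ t := by
  refine WDgr.le_of_mem_filtEdges h fun p => ?_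
  have := square_walk h1 p
  simpa [SquareBound] using this

lemma le_of_zero_three_mem_delete_filtEdges {W : ℝ} {hW : 0 < W} {t : ℝ}
    (h : ((0 : Fin 4), (3 : Fin 4)) ∈
      ((square W hW).deleteEdge (squareEdge W hW)).filtEdges t) : W + 1 ≤ t := by
  refine WDgr.le_of_mem_filtEdges h fun p => ?_
  have := square_delete_walk p
  simpa [SquareDeleteBound] using this

lemma square_cycles_mem_squarePairs {W : ℝ} {hW : 0 < W} (h1 : 1 ≤ W) {t : ℝ}
    {c : Chains (Fin 4) 1} (hc : c ∈ (square W hW).cycles t) : c ∈ allowedChains squarePairs 1 :=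
  allowedChains_mono (fun _ h => h.2.elim (fun h => squarePairs_of_square_edge h)
    fun h => squarePairs_of_square_filtEdges h1 h) 1 hc.1.1

/-- It suffices that `c` be supported on `G^t`. If `W ≤ t`, every edge has entered. If the
coefficient of `v₀v₂` vanishes, `c` is a multiple of the boundary of `v₀v₁v₃`; when nonzero it uses
`v₀v₃`, not an edge of `G`, which forces `2 ≤ t`, after both legs have entered. -/
lemma square_mem_boundaries {W : ℝ} {hW : 0 < W} (h1 : 1 ≤ W) {t : ℝ} {c : Chains (Fin 4) 1}
    (hc : c ∈ (square W hW).cycles t) (h : c ![0, 2] = 0 ∨ W ≤ t) :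
    c ∈ (square W hW).boundaries t := by
  have hpairs := square_cycles_mem_squarePairs h1 hc
  obtain ⟨h13, h23, h03⟩ := cycle_coefficients hpairs hc.2
  refine mem_boundary_of_squarePairs hpairs hc.2 ((Finsupp.mem_supported ℝ c).2 fun x hx => ?_)
  have hx0 : c x ≠ 0 := Finsupp.mem_support_iff.1 hx
  refine isAllowed_edge ?_
  rcases (pair_mem_of_mem_allowedChains hc.1.1 hx0).2 with hE | hF
  swap
  · exact hF
  refine WDgr.mem_filtEdges_of_edge hE ?_
  change (if (x 0, x 1) = ((0 : Fin 4), (2 : Fin 4)) then W else 1) ≤ t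
  rcases h with h | h
  swap
  · split_ifs <;> linarith
  have hx' : x = ![x 0, x 1] := by funext j; fin_cases j <;> rfl
  have h2 : x 0 = 2 ∨ (x 0, x 1) = ((0 : Fin 4), (2 : Fin 4)) ∨ c ![0, 1] ≠ 0 := by
    rcases hE with hE | hE | hE | hE <;> obtain ⟨ha, hb⟩ := Prod.mk.inj hE
    · rw [hx', ha, hb] at hx0; exact .inr (.inr hx0)
    · rw [hx', ha, hb] at hx0; exact .inr (.inr (h13 ▸ hx0))
    · exact .inr (.inl hE)
    · exact .inl ha
  rcases h2 with h2 | h2 | h2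
  · rcases hE with hE | hE | hE | hE <;> obtain ⟨ha, hb⟩ := Prod.mk.inj hE
    · rw [ha] at h2; exact absurd h2 (by decide)
    · rw [ha] at h2; exact absurd h2 (by decide)
    · rw [ha] at h2; exact absurd h2 (by decide)
    · rw [hx', ha, hb, h23] at hx0; exact absurd h hx0
  · obtain ⟨ha, hb⟩ := Prod.mk.inj h2
    rw [hx', ha, hb] at hx0; exact absurd h hx0
  · have h3 : c ![0, 3] ≠ 0 := by rw [h03, h, sub_zero]; exact neg_ne_zero.2 h2
    have h4 := (pair_mem_of_mem_allowedChains hc.1.1 h3).2.resolve_left zero_three_notMem_square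
    have h5 := two_le_of_zero_three_mem_filtEdges h1 h4
    split_ifs with h6
    · obtain ⟨ha, hb⟩ := Prod.mk.inj h6
      rw [hx', ha, hb] at hx0; exact absurd h hx0
    · linarith

/-- Without `v₁v₃` the coefficient of `v₀v₁` vanishes too, so a nonzero cycle is a multiple of the
boundary of `v₀v₂v₃`. It uses `v₀v₃`, so `W + 1 ≤ t` and both legs have entered. -/
lemma square_delete_cycles_le_boundaries (W : ℝ) (hW : 0 < W) (t : ℝ) :
    ((square W hW).deleteEdge (squareEdge W hW)).cycles t ≤
      ((square W hW).deleteEdge (squareEdge W hW)).boundaries t := by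
  intro c hc
  change Chains (Fin 4) 1 at c
  have hsub : ∀ τ ∈ ((square W hW).deleteEdge (squareEdge W hW)).groundedEdges t,
      τ ∈ squarePairs ∧ τ ≠ ((1 : Fin 4), (3 : Fin 4)) := fun τ hτ => hτ.2.elim
    (fun h => ⟨squarePairs_of_square_edge h.1, h.2⟩)
    fun h => squarePairs_of_square_delete_filtEdges h
  have hpairs : c ∈ allowedChains squarePairs 1 :=
    allowedChains_mono (fun τ hτ => (hsub τ hτ).1) 1 hc.1.1
  obtain ⟨h13, h23, h03⟩ := cycle_coefficients hpairs hc.2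
  have h13' : c ![1, 3] = 0 := by
    by_contra h0
    exact (hsub _ (pair_mem_of_mem_allowedChains hc.1.1 h0)).2 rfl
  refine mem_boundary_of_squarePairs hpairs hc.2 ((Finsupp.mem_supported ℝ c).2 fun x hx => ?_)
  have hx0 : c x ≠ 0 := Finsupp.mem_support_iff.1 hx
  have hx' : x = ![x 0, x 1] := by funext j; fin_cases j <;> rfl
  refine isAllowed_edge ?_
  rcases (pair_mem_of_mem_allowedChains hc.1.1 hx0).2 with hE | hF
  swap
  · exact hF
  have h02 : c ![0, 2] ≠ 0 := by
    rcases hE.1 with hE | hE | hE | hE <;> obtain ⟨ha, hb⟩ := Prod.mk.inj hE <;>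
      rw [hx', ha, hb] at hx0
    · exact absurd (h13.symm.trans h13') hx0
    · exact absurd h13' hx0
    · exact hx0
    · rwa [h23] at hx0
  have h3 : c ![0, 3] ≠ 0 := by rw [h03, ← h13, h13', neg_zero, zero_sub]; exact neg_ne_zero.2 h02
  have h4 := (pair_mem_of_mem_allowedChains hc.1.1 h3).2.resolve_left
    fun h => zero_three_notMem_square h.1
  have h5 := le_of_zero_three_mem_delete_filtEdges h4
  refine WDgr.mem_filtEdges_of_edge hE ?_
  change (if (x 0, x 1) = ((0 : Fin 4), (2 : Fin 4)) then W else 1) ≤ t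
  split_ifs <;> linarith

/-- The coefficient of the edge `v₀v₂`. -/
def coeffZeroTwo : Chains (Fin 4) 1 →ₗ[ℝ] ℝ := Finsupp.lapply ![0, 2]

/-- Membership in `Ω₂(G^t)` makes the boundary a chain on edges of `G^t`, and `v₀v₂` is not among
them before time `W`. -/
lemma square_boundaries_le_ker {W : ℝ} {hW : 0 < W} (h1 : 1 ≤ W) {t : ℝ} (ht : t < W) :
    (square W hW).boundaries t ≤ LinearMap.ker coeffZeroTwo := by
  rintro _ ⟨c, hc, rfl⟩
  by_contra h
  exact (le_of_zero_two_mem_filtEdges h1 (pair_mem_of_mem_allowedChains hc.2 h)).not_gt ht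

/-- The cycle going around the square. -/
def squareCycle : Chains (Fin 4) 1 :=
  Finsupp.single ![0, 2] 1 + Finsupp.single ![2, 3] 1 - Finsupp.single ![0, 1] 1 -
    Finsupp.single ![1, 3] 1

lemma coeffZeroTwo_squareCycle : coeffZeroTwo squareCycle = 1 := by
  simp [coeffZeroTwo, squareCycle]

lemma squareCycle_mem_cycles {W : ℝ} {hW : 0 < W} {t : ℝ} (ht : 0 ≤ t) :
    squareCycle ∈ (square W hW).cycles t := by
  have hmem : ∀ i j : Fin 4, (i, j) ∈ (square W hW).E →
      (Finsupp.single ![i, j] 1 : Chains (Fin 4) 1) ∈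
        allowedChains ((square W hW).groundedEdges t) 1 := fun i j h =>
    Finsupp.single_mem_supported ℝ _ (isAllowed_edge ⟨ht, .inl h⟩)
  refine ⟨⟨?_, (Finsupp.mem_supported ℝ _).2 fun x _ i => i.elim0⟩, ?_⟩
  · exact Submodule.sub_mem _ (Submodule.sub_mem _ (Submodule.add_mem _
      (hmem _ _ (.inr (.inr (.inl rfl)))) (hmem _ _ (.inr (.inr (.inr rfl)))))
      (hmem _ _ (.inl rfl))) (hmem _ _ (.inr (.inl rfl)))
  · change boundary (Fin 4) 0 squareCycle = 0
    simp only [squareCycle, map_add, map_sub, boundary_edge]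
    abel

open Classical in
/-- The coefficient of the edge `v₀v₂` on homology classes, where it is well defined. -/
def squareCoord (W : ℝ) (hW : 0 < W) (t : ℝ) : (square W hW).homology t →ₗ[ℝ] ℝ :=
  -- The zero branch is a mere default: `IntervalCoordinate` constrains the coordinate only at times
  -- inside the bar, where the inclusion holds.
  if h : (square W hW).boundaries t ≤ LinearMap.ker coeffZeroTwo then
    ((square W hW).boundaries t).liftQ coeffZeroTwo h ∘ₗ ((square W hW).homology t).subtype
  else 0

lemma squareCoord_apply {W : ℝ} {hW : 0 < W} {t : ℝ}
    (h : (square W hW).boundaries t ≤ LinearMap.ker coeffZeroTwo) (c : Chains (Fin 4) 1)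
    (hc : ((square W hW).boundaries t).mkQ c ∈ (square W hW).homology t) :
    squareCoord W hW t ⟨_, hc⟩ = coeffZeroTwo c := by
  rw [squareCoord, dif_pos h]
  rfl

lemma square_cycles_le_boundaries {W : ℝ} {hW : 0 < W} (h1 : 1 ≤ W) {t : ℝ}
    (ht : t ∉ Set.Ico 0 W) : (square W hW).cycles t ≤ (square W hW).boundaries t := by
  intro c hc
  change Chains (Fin 4) 1 at c
  refine square_mem_boundaries h1 hc ?_
  by_cases h0 : 0 ≤ t
  · exact .inr (not_lt.1 fun h => ht ⟨h0, h⟩)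
  -- At negative times there are no grounded edges, so all coefficients vanish.
  · left
    by_contra h
    exact h0 (pair_mem_of_mem_allowedChains hc.1.1 h).1

/-- The grounded persistent path homology of the square is the interval module of `[0, W)`. -/
def squareIntervalCoordinate (W : ℝ) (hW : 0 < W) (h1 : 1 ≤ W) :
    IntervalCoordinate (square W hW).persHomology (icoBar 0 W hW) where
  coord := squareCoord W hW
  subsingleton _ ht := WDgr.subsingleton_homology (square_cycles_le_boundaries h1 ht)
  bijective t ht := by
    have hk := square_boundaries_le_ker (hW := hW) h1 ht.2
    constructor
    · refine (injective_iff_map_eq_zero (squareCoord W hW t)).2 ?_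
      rintro ⟨_, c, hc, rfl⟩ h
      replace h : coeffZeroTwo c = 0 := (squareCoord_apply hk c ⟨c, hc, rfl⟩).symm.trans h
      exact Subtype.ext ((Submodule.Quotient.mk_eq_zero _).2 (square_mem_boundaries h1 hc (.inl h)))
    · intro r
      have hmem : ((square W hW).boundaries t).mkQ squareCycle ∈ (square W hW).homology t :=
        ⟨squareCycle, squareCycle_mem_cycles ht.1, rfl⟩
      refine ⟨r • (⟨_, hmem⟩ : (square W hW).homology t), ?_⟩
      refine (map_smul (squareCoord W hW t) _ _).trans ?_
      rw [squareCoord_apply hk, coeffZeroTwo_squareCycle, smul_eq_mul, mul_one]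
  naturality {s t} f hs ht := by
    rintro ⟨_, c, hc, rfl⟩
    exact (squareCoord_apply (square_boundaries_le_ker h1 ht.2) c
      ⟨c, (square W hW).cycles_mono f.le hc, rfl⟩).trans
      (squareCoord_apply (square_boundaries_le_ker h1 hs.2) c ⟨c, hc, rfl⟩).symm

/-! ### Barcodes and neighbourhood graphs of the family. -/

lemma isBarcode_square_iff {W : ℝ} (hW : 0 < W) (h1 : 1 ≤ W) (B : Barcode) :
    IsBarcode (square W hW).persHomology B ↔ B = {icoBar 0 W hW} :=
  (squareIntervalCoordinate W hW h1).isBarcode_iff B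

lemma isBarcode_square_delete_iff (W : ℝ) (hW : 0 < W) (B : Barcode) :
    IsBarcode ((square W hW).deleteEdge (squareEdge W hW)).persHomology B ↔ B = 0 :=
  isBarcode_iff_of_subsingleton (fun t => WDgr.subsingleton_homology
    (square_delete_cycles_le_boundaries W hW t)) B

lemma bottleneckDist_square {W : ℝ} (hW : 0 < W) (h1 : 1 ≤ W) :
    bottleneckDist (square W hW).barcode
      ((square W hW).deleteEdge (squareEdge W hW)).barcode = ENNReal.ofReal (W / 2) := by
  rw [WDgr.barcode, WDgr.barcode, barcode_eq (isBarcode_square_iff hW h1),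
    barcode_eq (isBarcode_square_delete_iff W hW), bottleneckDist_icoBar_zero]

lemma squareEdge_mem (W : ℝ) (hW : 0 < W) : squareEdge W hW ∈ (square W hW).E :=
  .inr (.inl rfl)

/-- Sharing `V` and `E` definitionally reduces equality of the digraphs to equality of weight
functions, with no transport along types. -/
lemma WDgr.inducedOnEdges_congr {V : Type} [Finite V] {E : Set (V × V)} {l : ∀ i, (i, i) ∉ E}
    {w w' : E → ℝ} {hw : ∀ e, 0 < w e} {hw' : ∀ e, 0 < w' e} {F : Set (V × V)} (hF : F ⊆ E)
    (h : ∀ τ (hτ : τ ∈ F), w ⟨τ, hF hτ⟩ = w' ⟨τ, hF hτ⟩) :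
    (WDgr.mk V E l w hw).inducedOnEdges F hF = (WDgr.mk V E l w' hw').inducedOnEdges F hF := by
  simp only [WDgr.inducedOnEdges, WDgr.mk.injEq, heq_eq_eq, true_and]
  funext τ
  exact h _ τ.2

lemma square_nbhdGraph_eq {W W' : ℝ} (hW : 0 < W) (hW' : 0 < W') :
    (square W hW).nbhdGraph {squareEdge W hW} = (square W' hW').nbhdGraph {squareEdge W' hW'} := by
  refine WDgr.inducedOnEdges_congr _ ?_
  rintro τ ⟨-, e, rfl, v, hv, hv'⟩
  have hτ : τ ≠ ((0 : Fin 4), (2 : Fin 4)) := by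
    rintro rfl
    have hdisj : ∀ v : Fin 4, v = 0 ∨ v = 2 → v = 1 ∨ v = 3 → False := by decide
    exact hdisj v hv hv'
  exact (if_neg hτ).trans (if_neg hτ).symm

end GrPPH

end

theorem mainTheorem12 :
    (¬ ∃ f : GrPPH.WDgr → ℝ, ∀ (G : GrPPH.WDgr) (e : G.V × G.V), e ∈ G.E →
      (GrPPH.bottleneckDist G.barcode (G.deleteEdge e).barcode : EReal) ≤
        (f (G.nbhdGraph {e}) : EReal)) ∧
    ∃ N : GrPPH.WDgr, ∀ (W : ℝ) (hW : 0 < W), 1 ≤ W →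
      GrPPH.squareEdge W hW ∈ (GrPPH.square W hW).E ∧
      (GrPPH.square W hW).nbhdGraph {GrPPH.squareEdge W hW} = N ∧
      (∀ B : GrPPH.Barcode, GrPPH.IsBarcode (GrPPH.square W hW).persHomology B ↔
        B = {GrPPH.icoBar 0 W hW}) ∧
      (∀ B : GrPPH.Barcode,
        GrPPH.IsBarcode ((GrPPH.square W hW).deleteEdge (GrPPH.squareEdge W hW)).persHomology B ↔
          B = 0) ∧
      GrPPH.bottleneckDist (GrPPH.square W hW).barcode
        ((GrPPH.square W hW).deleteEdge (GrPPH.squareEdge W hW)).barcode =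
          ENNReal.ofReal (W / 2) := by
  refine ⟨?_, (GrPPH.square 1 one_pos).nbhdGraph {GrPPH.squareEdge 1 one_pos},
    fun W hW h1 => ⟨GrPPH.squareEdge_mem W hW, GrPPH.square_nbhdGraph_eq hW one_pos,
      GrPPH.isBarcode_square_iff hW h1, GrPPH.isBarcode_square_delete_iff W hW,
      GrPPH.bottleneckDist_square hW h1⟩⟩
  rintro ⟨f, hf⟩
  set r := f ((GrPPH.square 1 one_pos).nbhdGraph {GrPPH.squareEdge 1 one_pos}) with hr
  have habs := le_abs_self r
  have h0 := abs_nonneg r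
  -- The value `r` is the same for all `W`; the choice `W = 2 * |r| + 1` is at least `1` and has `W
  -- / 2 > r`.
  have h1 : 1 ≤ 2 * |r| + 1 := by linarith
  have hW : 0 < 2 * |r| + 1 := by linarith
  have h := hf (GrPPH.square _ hW) (GrPPH.squareEdge _ hW) (GrPPH.squareEdge_mem _ hW)
  rw [GrPPH.bottleneckDist_square hW h1, GrPPH.square_nbhdGraph_eq hW one_pos, ← hr,
    EReal.coe_ennreal_ofReal, max_eq_left (by linarith), EReal.coe_le_coe_iff] at h
  linarith
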